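/- Let $n\ge 2$. Let $R_n$ be the disjoint union of $n$ rays, i.e. the set of pairs $(i,k)$ with $i\in\mathbb Z/n$ and $k\in\{1,2,3,\dots\}$, and let the Houghton group $H_n$ be the group of all permutations $\sigma$ of $R_n$ for which there are an integer $N\ge 0$ and integers $t_i$ ($i\in\mathbb Z/n$) such that $\sigma(i,k)=(i,k+t_i)$ for all $i$ and all $k\ge N$. A commensuration of a group $G$ is an isomorphism $\varphi\colon A\to B$ between subgroups $A,B$ of finite index in $G$; two commensurations are equivalent if they agree on some subgroup of finite index in $G$. The abstract commensurator $\mathrm{Com}(G)$ is the group of equivalence classes of commensurations under composition. For a metric space $X$, $\mathrm{QI}(X)$ is the group, under composition, of quasi-isometries $X\to X$ modulo the relation of being at bounded distance from each other. If $G$ is generated by a finite set $S$, then $G$ carries the word metric $d_S(x,y)=|x^{-1}y|_S$, $\mathrm{QI}(G)$ denotes the quasi-isometry group of $(G,d_S)$, and there is a natural homomorphism $\mathrm{Com}(G)\to\mathrm{QI}(G)$ that sends the class of $\varphi\colon A\to B$ to the class of the quasi-isometries $f\colon G\to G$ with $\sup_{a\in A}d_S(f(a),\varphi(a))<\infty$.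 Theorem. For $n\ge 2$ the group $H_n$ is finitely generated, and for every finite generating set of $H_n$ the natural homomorphism $\mathrm{Com}(H_n)\to\mathrm{QI}(H_n)$ is injective. Moreover, no nontrivial commensuration lies at bounded distance from the identity: if $S$ is a finite generating set and $\varphi\colon A\to B$ is a commensuration of $H_n$ that is not equivalent to the identity, then for every $N\in\mathbb N$ there is $\sigma\in A$ with $d_S(\sigma,\varphi(\sigma))\ge N$. -/

import Mathlib

/-! ### Houghton's groups -/

/-- `R_n`: the vertex set of `n` disjoint rays; `(i, k)` is the `k`-th vertex (`k ≥ 1`) of ray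
`i`. -/
abbrev Rays (n : ℕ) : Type := Fin n × ℕ+

/-- A permutation `σ` of `R_n` is eventually a translation of each ray: there are an `N` and
integers `t i` with `σ (i, k) = (i, k + t i)` for all `i` and all `k ≥ N`. -/
def IsEventuallyTranslation {n : ℕ} (σ : Equiv.Perm (Rays n)) : Prop :=
  ∃ (N : ℕ) (t : Fin n → ℤ), ∀ (i : Fin n) (k : ℕ+), N ≤ (k : ℕ) →
    (σ (i, k)).1 = i ∧ (((σ (i, k)).2 : ℕ) : ℤ) = ((k : ℕ) : ℤ) + t i

theorem IsEventuallyTranslation.one {n : ℕ} :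
    IsEventuallyTranslation (1 : Equiv.Perm (Rays n)) :=
  ⟨0, fun _ => 0, fun i k _ => by simp⟩

theorem IsEventuallyTranslation.mul {n : ℕ} {σ τ : Equiv.Perm (Rays n)}
    (hσ : IsEventuallyTranslation σ) (hτ : IsEventuallyTranslation τ) :
    IsEventuallyTranslation (σ * τ) := by
  obtain ⟨N, t, h⟩ := hσ
  obtain ⟨M, u, h'⟩ := hτ
  refine ⟨M + (N + ∑ i, (u i).natAbs), fun i => t i + u i, fun i k hk => ?_⟩
  obtain ⟨h1, h2⟩ := h' i k (by omega)
  have hi : (u i).natAbs ≤ ∑ i, (u i).natAbs :=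
    Finset.single_le_sum (f := fun i => (u i).natAbs) (fun _ _ => Nat.zero_le _)
      (Finset.mem_univ i)
  have he : τ (i, k) = (i, (τ (i, k)).2) := Prod.ext h1 rfl
  obtain ⟨h3, h4⟩ := h i (τ (i, k)).2 (by omega)
  rw [Equiv.Perm.mul_apply, he]
  exact ⟨h3, by rw [h4, h2]; ring⟩

theorem IsEventuallyTranslation.inv {n : ℕ} {σ : Equiv.Perm (Rays n)}
    (hσ : IsEventuallyTranslation σ) : IsEventuallyTranslation σ⁻¹ := by
  obtain ⟨N, t, h⟩ := hσ
  refine ⟨N + 1 + ∑ i, (t i).natAbs, fun i => -t i, fun i k hk => ?_⟩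
  have hi : (t i).natAbs ≤ ∑ i, (t i).natAbs :=
    Finset.single_le_sum (f := fun i => (t i).natAbs) (fun _ _ => Nat.zero_le _)
      (Finset.mem_univ i)
  have hpos : 0 < (((k : ℕ) : ℤ) - t i).toNat := by omega
  set m : ℕ+ := ⟨(((k : ℕ) : ℤ) - t i).toNat, hpos⟩ with hm
  have hmv : (m : ℕ) = (((k : ℕ) : ℤ) - t i).toNat := rfl
  obtain ⟨h1, h2⟩ := h i m (by omega)
  have hk' : σ (i, m) = (i, k) := by
    refine Prod.ext h1 (PNat.eq ?_)
    show ((σ (i, m)).2 : ℕ) = (k : ℕ)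
    have h3 : ((m : ℕ) : ℤ) = ((k : ℕ) : ℤ) - t i := by omega
    have h4 := h2
    omega
  have : σ⁻¹ (i, k) = (i, m) := by rw [← hk']; simp
  rw [this]
  refine ⟨rfl, ?_⟩
  show ((m : ℕ) : ℤ) = ((k : ℕ) : ℤ) + -t i
  omega

/-- The Houghton group `H_n`, a subgroup of the symmetric group on `R_n`. -/
def HoughtonGroup (n : ℕ) : Subgroup (Equiv.Perm (Rays n)) where
  carrier := {σ | IsEventuallyTranslation σ}
  one_mem' := IsEventuallyTranslation.one
  mul_mem' := IsEventuallyTranslation.mul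
  inv_mem' := IsEventuallyTranslation.inv

/-! ### The abstract commensurator -/

/-- A commensuration of `G`: an isomorphism between two subgroups of finite index. -/
structure Commensuration (G : Type*) [Group G] where
  dom : Subgroup G
  cod : Subgroup G
  finite_dom : dom.FiniteIndex
  finite_cod : cod.FiniteIndex
  iso : dom ≃* cod

namespace Commensuration

variable {G : Type*} [Group G]

/-- Two commensurations are equivalent if they agree on a subgroup of finite index. -/
def Equivalent (φ ψ : Commensuration G) : Prop :=
  ∃ A : Subgroup G, A.FiniteIndex ∧ ∃ (h₁ : A ≤ φ.dom) (h₂ : A ≤ ψ.dom),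
    ∀ (a : G) (ha : a ∈ A), (φ.iso ⟨a, h₁ ha⟩ : G) = (ψ.iso ⟨a, h₂ ha⟩ : G)

theorem Equivalent.refl (φ : Commensuration G) : φ.Equivalent φ :=
  ⟨φ.dom, φ.finite_dom, le_rfl, le_rfl, fun _ _ => rfl⟩

theorem Equivalent.symm {φ ψ : Commensuration G} (h : φ.Equivalent ψ) : ψ.Equivalent φ := by
  obtain ⟨A, hA, h₁, h₂, h⟩ := h
  exact ⟨A, hA, h₂, h₁, fun a ha => (h a ha).symm⟩

theorem Equivalent.trans {φ ψ χ : Commensuration G} (h : φ.Equivalent ψ)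
    (h' : ψ.Equivalent χ) : φ.Equivalent χ := by
  obtain ⟨A, hA, h₁, h₂, h⟩ := h
  obtain ⟨B, hB, h₃, h₄, h'⟩ := h'
  exact ⟨A ⊓ B, inferInstance, inf_le_left.trans h₁, inf_le_right.trans h₄,
    fun a ha => (h a ha.1).trans (h' a ha.2)⟩

instance setoid (G : Type*) [Group G] : Setoid (Commensuration G) where
  r := Equivalent
  iseqv := ⟨Equivalent.refl, Equivalent.symm, Equivalent.trans⟩

/-- The identity commensuration. -/
def id (G : Type*) [Group G] : Commensuration G where
  dom := ⊤
  cod := ⊤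
  finite_dom := inferInstance
  finite_cod := inferInstance
  iso := MulEquiv.refl _

/-- The inverse commensuration. -/
def symm (φ : Commensuration G) : Commensuration G where
  dom := φ.cod
  cod := φ.dom
  finite_dom := φ.finite_cod
  finite_cod := φ.finite_dom
  iso := φ.iso.symm

/-- The preimage `{g ∈ dom φ | φ g ∈ K}` of a subgroup `K` of `G`. -/
def preimage (φ : Commensuration G) (K : Subgroup G) : Subgroup G :=
  (K.comap (φ.cod.subtype.comp φ.iso.toMonoidHom)).map φ.dom.subtype

theorem mem_preimage {φ : Commensuration G} {K : Subgroup G} {g : G} :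
    g ∈ φ.preimage K ↔ ∃ h : g ∈ φ.dom, (φ.iso ⟨g, h⟩ : G) ∈ K := by
  simp [preimage]

theorem finiteIndex_preimage (φ : Commensuration G) (K : Subgroup G) [hK : K.FiniteIndex] :
    (φ.preimage K).FiniteIndex := by
  have := φ.finite_cod
  have := φ.finite_dom
  have h1 : (K.comap φ.cod.subtype).FiniteIndex :=
    inferInstanceAs (K.subgroupOf φ.cod).FiniteIndex
  have h2 : (K.comap (φ.cod.subtype.comp φ.iso.toMonoidHom)).index ≠ 0 := by
    rw [← Subgroup.comap_comap, Subgroup.index_comap_of_surjective _ φ.iso.surjective]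
    exact h1.index_ne_zero
  refine ⟨?_⟩
  rw [preimage, Subgroup.index_map_subtype]
  exact mul_ne_zero h2 φ.finite_dom.index_ne_zero

/-- The composite `ψ ∘ φ`, defined on `{g ∈ dom φ | φ g ∈ dom ψ}`. -/
def comp (ψ φ : Commensuration G) : Commensuration G where
  dom := φ.preimage ψ.dom
  cod := ψ.symm.preimage φ.cod
  finite_dom := haveI := ψ.finite_dom; φ.finiteIndex_preimage ψ.dom
  finite_cod := haveI := φ.finite_cod; ψ.symm.finiteIndex_preimage φ.cod
  iso :=
    { toFun := fun x => ⟨ψ.iso ⟨φ.iso ⟨x.1, (mem_preimage.1 x.2).1⟩, (mem_preimage.1 x.2).2⟩,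
        mem_preimage.2 ⟨SetLike.coe_mem _, by
          show (ψ.iso.symm (ψ.iso _) : G) ∈ φ.cod
          rw [MulEquiv.symm_apply_apply]
          exact SetLike.coe_mem _⟩⟩
      invFun := fun y =>
        ⟨φ.iso.symm ⟨ψ.iso.symm ⟨y.1, (mem_preimage.1 y.2).1⟩, (mem_preimage.1 y.2).2⟩,
          mem_preimage.2 ⟨SetLike.coe_mem _, by
            show (φ.iso (φ.iso.symm _) : G) ∈ ψ.dom
            rw [MulEquiv.apply_symm_apply]
            exact SetLike.coe_mem _⟩⟩
      left_inv := fun x => Subtype.ext <| by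
        have e : ψ.iso.symm (ψ.iso ⟨φ.iso ⟨x.1, (mem_preimage.1 x.2).1⟩,
          (mem_preimage.1 x.2).2⟩) = _ := ψ.iso.symm_apply_apply _
        have e' : φ.iso.symm ⟨ψ.iso.symm (ψ.iso ⟨φ.iso ⟨x.1, (mem_preimage.1 x.2).1⟩,
          (mem_preimage.1 x.2).2⟩), by rw [e]; exact SetLike.coe_mem _⟩ =
            ⟨x.1, (mem_preimage.1 x.2).1⟩ := by
          rw [MulEquiv.symm_apply_eq]
          exact Subtype.ext (Subtype.ext_iff.1 e :)
        exact (Subtype.ext_iff.1 e' :)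
      right_inv := fun y => Subtype.ext <| by
        have e : φ.iso (φ.iso.symm ⟨ψ.iso.symm ⟨y.1, (mem_preimage.1 y.2).1⟩,
          (mem_preimage.1 y.2).2⟩) = _ := φ.iso.apply_symm_apply _
        have e' : ψ.iso ⟨φ.iso (φ.iso.symm ⟨ψ.iso.symm ⟨y.1, (mem_preimage.1 y.2).1⟩,
          (mem_preimage.1 y.2).2⟩), by rw [e]; exact SetLike.coe_mem _⟩ =
            ⟨y.1, (mem_preimage.1 y.2).1⟩ := by
          rw [← MulEquiv.eq_symm_apply]
          exact Subtype.ext (Subtype.ext_iff.1 e :)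
        exact (Subtype.ext_iff.1 e' :)
      map_mul' := fun x y => Subtype.ext <| by
        have e : φ.iso ⟨(x * y).1, (mem_preimage.1 (x * y).2).1⟩ =
            φ.iso ⟨x.1, (mem_preimage.1 x.2).1⟩ * φ.iso ⟨y.1, (mem_preimage.1 y.2).1⟩ :=
          map_mul φ.iso ⟨x.1, (mem_preimage.1 x.2).1⟩ ⟨y.1, (mem_preimage.1 y.2).1⟩
        have e' : ψ.iso ⟨φ.iso ⟨(x * y).1, _⟩, (mem_preimage.1 (x * y).2).2⟩ =
            ψ.iso ⟨φ.iso ⟨x.1, _⟩, (mem_preimage.1 x.2).2⟩ *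
              ψ.iso ⟨φ.iso ⟨y.1, _⟩, (mem_preimage.1 y.2).2⟩ := by
          rw [← map_mul]
          exact congrArg ψ.iso (Subtype.ext (Subtype.ext_iff.1 e :))
        exact (Subtype.ext_iff.1 e' :) }

theorem comp_congr {ψ ψ' φ φ' : Commensuration G} (hψ : ψ.Equivalent ψ')
    (hφ : φ.Equivalent φ') : (ψ.comp φ).Equivalent (ψ'.comp φ') := by
  obtain ⟨A, hA, a₁, a₂, ha⟩ := hψ
  obtain ⟨B, hB, b₁, b₂, hb⟩ := hφ
  have := φ.finiteIndex_preimage A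
  refine ⟨B ⊓ φ.preimage A, inferInstance, fun x hx => ?_, fun x hx => ?_, fun x hx => ?_⟩
  · obtain ⟨h1, h2⟩ := mem_preimage.1 hx.2
    exact mem_preimage.2 ⟨h1, a₁ h2⟩
  · obtain ⟨h1, h2⟩ := mem_preimage.1 hx.2
    exact mem_preimage.2 ⟨b₂ hx.1, a₂ (by rw [← hb x hx.1]; exact h2)⟩
  · obtain ⟨h1, h2⟩ := mem_preimage.1 hx.2
    show (ψ.iso ⟨φ.iso ⟨x, _⟩, _⟩ : G) = (ψ'.iso ⟨φ'.iso ⟨x, _⟩, _⟩ : G)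
    rw [ha _ h2]
    congr 2
    exact Subtype.ext (hb x hx.1)

theorem symm_congr {φ ψ : Commensuration G} (h : φ.Equivalent ψ) :
    φ.symm.Equivalent ψ.symm := by
  obtain ⟨A, hA, a₁, a₂, ha⟩ := h
  have key : ∀ x ∈ φ.symm.preimage A, ∃ (h1 : x ∈ φ.cod) (h2 : x ∈ ψ.cod),
      (φ.iso.symm ⟨x, h1⟩ : G) = ψ.iso.symm ⟨x, h2⟩ := by
    intro x hx
    obtain ⟨h1, h2⟩ := mem_preimage.1 hx
    have e := ha _ h2
    have e1 : (φ.iso ⟨φ.symm.iso ⟨x, h1⟩, a₁ h2⟩ : G) = x :=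
      congrArg Subtype.val (φ.iso.apply_symm_apply ⟨x, h1⟩)
    rw [e1] at e
    have hx' : x ∈ ψ.cod := by rw [e]; exact SetLike.coe_mem _
    refine ⟨h1, hx', ?_⟩
    have : (⟨x, hx'⟩ : ψ.cod) = ψ.iso ⟨φ.symm.iso ⟨x, h1⟩, a₂ h2⟩ := Subtype.ext e
    rw [this, MulEquiv.symm_apply_apply]
    rfl
  refine ⟨φ.symm.preimage A, φ.symm.finiteIndex_preimage A, fun x hx => (key x hx).1,
    fun x hx => (key x hx).2.1, fun x hx => (key x hx).2.2⟩

end Commensuration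

/-- The abstract commensurator `Com(G)`. -/
def Com (G : Type*) [Group G] : Type _ := Quotient (Commensuration.setoid G)

namespace Com

open Commensuration

variable {G : Type*} [Group G]

/-- The class of a commensuration in `Com(G)`. -/
def mk (φ : Commensuration G) : Com G := Quotient.mk _ φ

/-- `Com(G)` is a group under composition (where defined). -/
instance : Group (Com G) where
  mul := Quotient.map₂ comp fun _ _ h _ _ h' => comp_congr h h'
  one := mk (Commensuration.id G)
  inv := Quotient.map symm fun _ _ h => symm_congr h
  mul_assoc := by
    rintro ⟨χ⟩ ⟨ψ⟩ ⟨φ⟩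
    refine Quotient.sound ⟨((χ.comp ψ).comp φ).dom, ((χ.comp ψ).comp φ).finite_dom, le_rfl,
      fun x hx => ?_, fun x hx => rfl⟩
    obtain ⟨h1, h2⟩ := mem_preimage.1 hx
    obtain ⟨h3, h4⟩ := mem_preimage.1 h2
    exact mem_preimage.2 ⟨mem_preimage.2 ⟨h1, h3⟩, h4⟩
  one_mul := by
    rintro ⟨φ⟩
    refine Quotient.sound ⟨φ.dom, φ.finite_dom, fun x hx => ?_, le_rfl, fun x hx => rfl⟩
    exact mem_preimage.2 ⟨hx, Subgroup.mem_top _⟩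
  mul_one := by
    rintro ⟨φ⟩
    refine Quotient.sound ⟨φ.dom, φ.finite_dom, fun x hx => ?_, le_rfl, fun x hx => rfl⟩
    exact mem_preimage.2 ⟨Subgroup.mem_top _, hx⟩
  inv_mul_cancel := by
    rintro ⟨φ⟩
    refine Quotient.sound ⟨φ.dom, φ.finite_dom, fun x hx => ?_, le_top, fun x hx => ?_⟩
    · exact mem_preimage.2 ⟨hx, SetLike.coe_mem _⟩
    · exact congrArg Subtype.val (φ.iso.symm_apply_apply ⟨x, hx⟩)

end Com

/-! ### The quasi-isometry group of a metric space -/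

/-- `f : X → Y` is a quasi-isometry: a coarsely surjective quasi-isometric embedding. -/
def IsQuasiIsometry {X Y : Type*} [PseudoMetricSpace X] [PseudoMetricSpace Y]
    (f : X → Y) : Prop :=
  ∃ K C : ℝ, 1 ≤ K ∧ 0 ≤ C ∧
    (∀ x y, K⁻¹ * dist x y - C ≤ dist (f x) (f y) ∧ dist (f x) (f y) ≤ K * dist x y + C) ∧
    ∀ y, ∃ x, dist (f x) y ≤ C

/-- `f` and `g` are at bounded distance from each other. -/
def BoundedDistance {X Y : Type*} [PseudoMetricSpace Y] (f g : X → Y) : Prop :=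
  ∃ C : ℝ, ∀ x, dist (f x) (g x) ≤ C

namespace BoundedDistance

variable {X Y : Type*} [PseudoMetricSpace Y]

theorem refl (f : X → Y) : BoundedDistance f f := ⟨0, fun x => by simp⟩

theorem symm {f g : X → Y} (h : BoundedDistance f g) : BoundedDistance g f := by
  obtain ⟨C, h⟩ := h
  exact ⟨C, fun x => by rw [dist_comm]; exact h x⟩

theorem trans {f g k : X → Y} (h : BoundedDistance f g) (h' : BoundedDistance g k) :
    BoundedDistance f k := by
  obtain ⟨C, h⟩ := h
  obtain ⟨D, h'⟩ := h'
  exact ⟨C + D, fun x => (dist_triangle _ (g x) _).trans (add_le_add (h x) (h' x))⟩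

end BoundedDistance

/-- Coarsely Lipschitz maps with a coarsely Lipschitz coarse inverse are quasi-isometries. -/
theorem IsQuasiIsometry.of_coarseInverse {X Y : Type*} [PseudoMetricSpace X]
    [PseudoMetricSpace Y] {f : X → Y} {g : Y → X} {K L C D : ℝ}
    (hf : ∀ x y, dist (f x) (f y) ≤ K * dist x y + C)
    (hg : ∀ x y, dist (g x) (g y) ≤ L * dist x y + C)
    (hgf : ∀ x, dist (g (f x)) x ≤ D) (hfg : ∀ y, dist (f (g y)) y ≤ D) :
    IsQuasiIsometry f := by
  set M := max 1 (max K L) with hM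
  have hM1 : (1 : ℝ) ≤ M := le_max_left _ _
  have hKM : K ≤ M := (le_max_left _ _).trans (le_max_right _ _)
  have hLM : L ≤ M := (le_max_right _ _).trans (le_max_right _ _)
  refine ⟨M, |C| + 2 * |D|, hM1, by positivity, fun x y => ⟨?_, ?_⟩, fun y => ⟨g y, ?_⟩⟩
  · have h1 := hg (f x) (f y)
    have h2 := hgf x
    have h3 := hgf y
    have h4 : dist x y ≤ _ := dist_triangle4 x (g (f x)) (g (f y)) y
    rw [dist_comm x (g (f x))] at h4
    have h5 : L * dist (f x) (f y) ≤ M * dist (f x) (f y) :=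
      mul_le_mul_of_nonneg_right hLM dist_nonneg
    have h6 : dist x y ≤ M * (dist (f x) (f y) + (|C| + 2 * |D|)) := by
      have := le_abs_self C
      have := le_abs_self D
      have : |C| + 2 * |D| ≤ M * (|C| + 2 * |D|) := le_mul_of_one_le_left (by positivity) hM1
      linarith
    have h7 : M⁻¹ * dist x y ≤ dist (f x) (f y) + (|C| + 2 * |D|) := by
      rw [inv_mul_le_iff₀ (by linarith)]
      exact h6
    linarith
  · have h1 := hf x y
    have h5 : K * dist x y ≤ M * dist x y := mul_le_mul_of_nonneg_right hKM dist_nonneg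
    have := le_abs_self C
    have := abs_nonneg D
    linarith
  · have := hfg y
    have := le_abs_self D
    have := abs_nonneg C
    have := abs_nonneg D
    linarith

theorem IsQuasiIsometry.id (X : Type*) [PseudoMetricSpace X] :
    IsQuasiIsometry (fun x : X => x) :=
  ⟨1, 0, le_rfl, le_rfl, fun x y => by simp, fun y => ⟨y, by simp⟩⟩

theorem IsQuasiIsometry.comp {X Y Z : Type*} [PseudoMetricSpace X] [PseudoMetricSpace Y]
    [PseudoMetricSpace Z] {g : Y → Z} {f : X → Y} (hg : IsQuasiIsometry g)
    (hf : IsQuasiIsometry f) : IsQuasiIsometry (fun x => g (f x)) := by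
  obtain ⟨K, C, hK, hC, h, hs⟩ := hg
  obtain ⟨L, D, hL, hD, h', hs'⟩ := hf
  have hKi : K⁻¹ ≤ 1 := inv_le_one_of_one_le₀ hK
  refine ⟨K * L, K * D + 2 * C, by nlinarith, by positivity, fun x y => ⟨?_, ?_⟩, fun z => ?_⟩
  · have h1 := (h (f x) (f y)).1
    have h2 := mul_le_mul_of_nonneg_left (h' x y).1 (inv_nonneg.2 (by linarith : 0 ≤ K))
    rw [mul_inv, mul_assoc]
    have h3 : K⁻¹ * D ≤ K * D := mul_le_mul_of_nonneg_right (hKi.trans hK) hD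
    rw [mul_sub] at h2
    linarith
  · have h1 := (h (f x) (f y)).2
    have h2 := mul_le_mul_of_nonneg_left (h' x y).2 (by linarith : 0 ≤ K)
    rw [mul_add, ← mul_assoc] at h2
    linarith
  · obtain ⟨y, hy⟩ := hs z
    obtain ⟨x, hx⟩ := hs' y
    refine ⟨x, ?_⟩
    have h1 := (h (f x) y).2
    have h2 := mul_le_mul_of_nonneg_left hx (by linarith : 0 ≤ K)
    have h3 := dist_triangle (g (f x)) (g y) z
    linarith

/-- A quasi-isometry has a quasi-inverse. -/
theorem IsQuasiIsometry.exists_quasiInverse {X Y : Type*} [PseudoMetricSpace X]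
    [PseudoMetricSpace Y] {f : X → Y} (hf : IsQuasiIsometry f) :
    ∃ g : Y → X, IsQuasiIsometry g ∧ BoundedDistance (fun x => g (f x)) (fun x => x) ∧
      BoundedDistance (fun y => f (g y)) (fun y => y) := by
  obtain ⟨K, C, hK, hC, h, hs⟩ := hf
  choose g hg using hs
  have hlow : ∀ x y, dist x y ≤ K * dist (f x) (f y) + K * C := fun x y => by
    have h1 := (h x y).1
    have h2 : K⁻¹ * dist x y ≤ dist (f x) (f y) + C := by linarith
    rw [inv_mul_le_iff₀ (by linarith)] at h2
    linarith
  have hgf : ∀ x, dist (g (f x)) x ≤ 2 * K * C := fun x => by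
    have h1 := hlow (g (f x)) x
    have h2 := mul_le_mul_of_nonneg_left (hg (f x)) (by linarith : 0 ≤ K)
    linarith
  have hgl : ∀ y z, dist (g y) (g z) ≤ K * dist y z + 3 * K * C := fun y z => by
    have h1 := hlow (g y) (g z)
    have h2 := dist_triangle4 (f (g y)) y z (f (g z))
    rw [dist_comm z] at h2
    have h3 := hg y
    have h4 := hg z
    have h5 : dist (f (g y)) (f (g z)) ≤ dist y z + 2 * C := by linarith
    have h6 := mul_le_mul_of_nonneg_left h5 (by linarith : 0 ≤ K)
    linarith
  have hKC : C ≤ K * C := le_mul_of_one_le_left hC hK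
  refine ⟨g, ?_, ⟨_, hgf⟩, ⟨C, hg⟩⟩
  refine IsQuasiIsometry.of_coarseInverse (g := f) (K := K) (L := K) (C := 3 * K * C)
    (D := 2 * K * C) hgl (fun x y => ?_) (fun y => ?_) hgf
  · have := (h x y).2
    nlinarith
  · have := hg y
    nlinarith

/-- The self-quasi-isometries of `X`. -/
def SelfQuasiIsometry (X : Type*) [PseudoMetricSpace X] : Type _ :=
  {f : X → X // IsQuasiIsometry f}

namespace SelfQuasiIsometry

variable {X : Type*} [PseudoMetricSpace X]

instance setoid (X : Type*) [PseudoMetricSpace X] : Setoid (SelfQuasiIsometry X) where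
  r f g := BoundedDistance f.1 g.1
  iseqv := ⟨fun f => BoundedDistance.refl f.1, BoundedDistance.symm, BoundedDistance.trans⟩

/-- Composition of self-quasi-isometries. -/
def comp (g f : SelfQuasiIsometry X) : SelfQuasiIsometry X :=
  ⟨fun x => g.1 (f.1 x), g.2.comp f.2⟩

theorem comp_congr {g g' f f' : SelfQuasiIsometry X} (hg : BoundedDistance g.1 g'.1)
    (hf : BoundedDistance f.1 f'.1) : BoundedDistance (g.comp f).1 (g'.comp f').1 := by
  obtain ⟨D, hD⟩ := hg
  obtain ⟨E, hE⟩ := hf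
  obtain ⟨K, C, hK, hC, h, -⟩ := g.2
  refine ⟨K * E + C + D, fun x => ?_⟩
  have h1 := dist_triangle (g.1 (f.1 x)) (g.1 (f'.1 x)) (g'.1 (f'.1 x))
  have h2 := (h (f.1 x) (f'.1 x)).2
  have h3 := mul_le_mul_of_nonneg_left (hE x) (by linarith : 0 ≤ K)
  have h4 := hD (f'.1 x)
  show dist (g.1 (f.1 x)) (g'.1 (f'.1 x)) ≤ _
  linarith

/-- A (chosen) quasi-inverse of a self-quasi-isometry. -/
noncomputable def quasiInverse (f : SelfQuasiIsometry X) : SelfQuasiIsometry X :=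
  ⟨f.2.exists_quasiInverse.choose, f.2.exists_quasiInverse.choose_spec.1⟩

theorem quasiInverse_comp (f : SelfQuasiIsometry X) :
    BoundedDistance (f.quasiInverse.comp f).1 (fun x => x) :=
  f.2.exists_quasiInverse.choose_spec.2.1

theorem comp_quasiInverse (f : SelfQuasiIsometry X) :
    BoundedDistance (f.comp f.quasiInverse).1 (fun x => x) :=
  f.2.exists_quasiInverse.choose_spec.2.2

theorem quasiInverse_congr {f g : SelfQuasiIsometry X} (h : BoundedDistance f.1 g.1) :
    BoundedDistance f.quasiInverse.1 g.quasiInverse.1 := by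
  have h1 : BoundedDistance (f.quasiInverse.comp (f.comp g.quasiInverse)).1
      (f.quasiInverse.comp (g.comp g.quasiInverse)).1 :=
    comp_congr (BoundedDistance.refl _) (comp_congr h (BoundedDistance.refl _))
  have h2 : BoundedDistance (f.quasiInverse.comp (g.comp g.quasiInverse)).1 f.quasiInverse.1 :=
    comp_congr (f' := ⟨fun x => x, IsQuasiIsometry.id X⟩) (BoundedDistance.refl _)
      g.comp_quasiInverse
  have h3 : BoundedDistance ((f.quasiInverse.comp f).comp g.quasiInverse).1 g.quasiInverse.1 :=
    comp_congr (g' := ⟨fun x => x, IsQuasiIsometry.id X⟩) f.quasiInverse_comp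
      (BoundedDistance.refl _)
  exact (h2.symm.trans h1.symm).trans h3

end SelfQuasiIsometry

/-- The quasi-isometry group `QI(X)`: self-quasi-isometries up to bounded distance. -/
def QI (X : Type*) [PseudoMetricSpace X] : Type _ := Quotient (SelfQuasiIsometry.setoid X)

namespace QI

open SelfQuasiIsometry

variable {X : Type*} [PseudoMetricSpace X]

/-- The class of a quasi-isometry in `QI(X)`. -/
def mk (f : X → X) (hf : IsQuasiIsometry f) : QI X :=
  Quotient.mk (SelfQuasiIsometry.setoid X) ⟨f, hf⟩

theorem mk_eq_mk {f g : X → X} {hf : IsQuasiIsometry f} {hg : IsQuasiIsometry g} :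
    mk f hf = mk g hg ↔ BoundedDistance f g :=
  Quotient.eq (r := SelfQuasiIsometry.setoid X)

/-- `QI(X)` is a group under composition. -/
noncomputable instance : Group (QI X) where
  mul := Quotient.map₂ comp fun _ _ h _ _ h' => comp_congr h h'
  one := mk (fun x => x) (IsQuasiIsometry.id X)
  inv := Quotient.map quasiInverse fun _ _ h => quasiInverse_congr h
  mul_assoc := by
    rintro ⟨f⟩ ⟨g⟩ ⟨h⟩
    rfl
  one_mul := by
    rintro ⟨f⟩
    rfl
  mul_one := by
    rintro ⟨f⟩
    rfl
  inv_mul_cancel := by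
    rintro ⟨f⟩
    exact Quotient.sound f.quasiInverse_comp

end QI

/-! ### Word metrics -/

section WordMetric

variable {G : Type*} [Group G]

/-- The word length of `g` with respect to `S`: the least length of a word in `S ∪ S⁻¹` that
represents `g`. -/
noncomputable def wordLength (S : Set G) (g : G) : ℕ :=
  sInf {n : ℕ | ∃ l : List G, (∀ x ∈ l, x ∈ S ∨ x⁻¹ ∈ S) ∧ l.prod = g ∧ l.length = n}

theorem exists_word {S : Set G} (hS : Subgroup.closure S = ⊤) (g : G) :
    ∃ l : List G, (∀ x ∈ l, x ∈ S ∨ x⁻¹ ∈ S) ∧ l.prod = g ∧ l.length = wordLength S g := by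
  have hg : g ∈ Subgroup.closure S := hS ▸ Subgroup.mem_top g
  rw [← Subgroup.mem_toSubmonoid, Subgroup.closure_toSubmonoid] at hg
  obtain ⟨l, hl, hp⟩ := Submonoid.exists_list_of_mem_closure hg
  exact Nat.sInf_mem
    (s := {n : ℕ | ∃ l : List G, (∀ x ∈ l, x ∈ S ∨ x⁻¹ ∈ S) ∧ l.prod = g ∧ l.length = n})
    ⟨l.length, l, hl, hp, rfl⟩

theorem wordLength_prod_le {S : Set G} {l : List G} (hl : ∀ x ∈ l, x ∈ S ∨ x⁻¹ ∈ S) :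
    wordLength S l.prod ≤ l.length :=
  Nat.sInf_le ⟨l, hl, rfl, rfl⟩

theorem wordLength_one (S : Set G) : wordLength S (1 : G) = 0 := by
  have := wordLength_prod_le (S := S) (l := []) (by simp)
  simpa using this

theorem wordLength_mul_le {S : Set G} (hS : Subgroup.closure S = ⊤) (g h : G) :
    wordLength S (g * h) ≤ wordLength S g + wordLength S h := by
  obtain ⟨l, hl, rfl, hn⟩ := exists_word hS g
  obtain ⟨m, hm, rfl, hk⟩ := exists_word hS h
  rw [← hn, ← hk, ← List.prod_append, ← List.length_append]
  exact wordLength_prod_le fun x hx => (List.mem_append.1 hx).elim (hl x) (hm x)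

theorem wordLength_inv_le {S : Set G} (hS : Subgroup.closure S = ⊤) (g : G) :
    wordLength S g⁻¹ ≤ wordLength S g := by
  obtain ⟨l, hl, rfl, hn⟩ := exists_word hS g
  rw [← hn, List.prod_inv_reverse]
  refine (wordLength_prod_le fun x hx => ?_).trans (by simp)
  obtain ⟨y, hy, rfl⟩ := List.mem_map.1 (List.mem_reverse.1 hx)
  simpa [or_comm] using hl y hy

theorem wordLength_inv {S : Set G} (hS : Subgroup.closure S = ⊤) (g : G) :
    wordLength S g⁻¹ = wordLength S g :=
  le_antisymm (wordLength_inv_le hS g) (by simpa using wordLength_inv_le hS g⁻¹)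

/-- The left-invariant word metric `d(x, y) = |x⁻¹ y|`. -/
noncomputable def wordDist (S : Set G) (x y : G) : ℝ := (wordLength S (x⁻¹ * y) : ℝ)

theorem wordDist_self (S : Set G) (x : G) : wordDist S x x = 0 := by
  rw [wordDist, inv_mul_cancel, wordLength_one, Nat.cast_zero]

theorem wordDist_comm {S : Set G} (hS : Subgroup.closure S = ⊤) (x y : G) :
    wordDist S x y = wordDist S y x := by
  rw [wordDist, wordDist, ← wordLength_inv hS, mul_inv_rev, inv_inv]

theorem wordDist_triangle {S : Set G} (hS : Subgroup.closure S = ⊤) (x y z : G) :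
    wordDist S x z ≤ wordDist S x y + wordDist S y z := by
  have h := wordLength_mul_le hS (x⁻¹ * y) (y⁻¹ * z)
  rw [show x⁻¹ * y * (y⁻¹ * z) = x⁻¹ * z by group] at h
  unfold wordDist
  exact_mod_cast h

theorem wordDist_triangle4 {S : Set G} (hS : Subgroup.closure S = ⊤) (x y z w : G) :
    wordDist S x w ≤ wordDist S x y + wordDist S y z + wordDist S z w :=
  (wordDist_triangle hS x z w).trans
    (add_le_add (wordDist_triangle hS x y z) le_rfl)

/-- The group `G` as a metric space, with the word metric of a generating set `S`. -/
def WordMetricSpace (S : Set G) (_hS : Subgroup.closure S = ⊤) : Type _ := G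

noncomputable instance (S : Set G) (hS : Subgroup.closure S = ⊤) :
    PseudoMetricSpace (WordMetricSpace S hS) where
  dist := wordDist (G := G) S
  dist_self := wordDist_self (G := G) S
  dist_comm := wordDist_comm (G := G) hS
  dist_triangle := wordDist_triangle (G := G) hS

end WordMetric

/-! ### The natural homomorphism from the commensurator to the quasi-isometry group -/

namespace Commensuration

variable {G : Type*} [Group G]

/-- A map `G → A`, at bounded distance from the identity if `A` has finite index: multiply `g`
on the right by one of the fixed coset representatives so as to land in `A`. -/
noncomputable def proj (A : Subgroup G) (g : G) : A :=
  ⟨g * (Quotient.out (QuotientGroup.mk g⁻¹ : G ⧸ A)), by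
    obtain ⟨h, hh⟩ := QuotientGroup.mk_out_eq_mul A g⁻¹
    rw [hh, mul_inv_cancel_left]
    exact h.2⟩

/-- The map `G → G` induced by a commensuration `φ`: move to the domain of `φ`, apply `φ`. -/
noncomputable def toMap (φ : Commensuration G) (g : G) : G := (φ.iso (proj φ.dom g) : G)

variable {S : Set G}

theorem exists_dist_proj_le (S : Set G) (A : Subgroup G) [A.FiniteIndex] :
    ∃ C : ℝ, ∀ g : G, wordDist S g (proj A g : G) ≤ C := by
  obtain ⟨C, hC⟩ := (Set.finite_range fun q : G ⧸ A => wordLength S q.out).bddAbove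
  refine ⟨C, fun g => ?_⟩
  rw [wordDist]
  have : g⁻¹ * (proj A g : G) = (QuotientGroup.mk g⁻¹ : G ⧸ A).out := by
    simp [proj]
  rw [this]
  exact_mod_cast hC ⟨_, rfl⟩

/-- On its domain, the commensuration is at bounded distance from the induced map. -/
theorem exists_dist_toMap_le (hS : Subgroup.closure S = ⊤) (φ : Commensuration G) :
    ∃ C : ℝ, ∀ a : φ.dom,
      wordDist S (φ.toMap a) (φ.iso a : G) ≤ C := by
  have := φ.finite_dom
  classical
  let F : G ⧸ φ.dom → ℕ := fun q =>
    if h : q.out ∈ φ.dom then wordLength S (φ.iso ⟨q.out, h⟩ : G) else 0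
  obtain ⟨C, hC⟩ := (Set.finite_range F).bddAbove
  refine ⟨C, fun a => ?_⟩
  rw [wordDist_comm hS, wordDist]
  set q : G ⧸ φ.dom := QuotientGroup.mk (a : G)⁻¹ with hq
  have hp : (proj φ.dom a : G) = a * q.out := rfl
  have h : q.out ∈ φ.dom := by
    have := (proj φ.dom (a : G)).2
    rw [hp] at this
    exact (Subgroup.mul_mem_cancel_left _ a.2).1 this
  have hp' : proj φ.dom (a : G) = a * ⟨q.out, h⟩ := Subtype.ext hp
  have : (φ.iso a : G)⁻¹ * φ.toMap a = φ.iso ⟨q.out, h⟩ := by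
    rw [toMap, hp', map_mul]
    simp
  rw [this]
  have := hC ⟨q, rfl⟩
  simp only [F, dif_pos h] at this
  exact_mod_cast this

/-- The induced map is Lipschitz. -/
theorem exists_lipschitz_toMap (hS : Subgroup.closure S = ⊤) (hfin : S.Finite)
    (φ : Commensuration G) :
    ∃ K : ℝ, 0 ≤ K ∧ ∀ g h : G, wordDist S (φ.toMap g) (φ.toMap h) ≤
      K * wordDist S g h := by
  have := φ.finite_dom
  have := hfin.to_subtype
  classical
  let F : (G ⧸ φ.dom) × (G ⧸ φ.dom) × S → ℕ := fun q =>
    if h : q.1.out⁻¹ * q.2.2 * q.2.1.out ∈ φ.dom then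
      wordLength S (φ.iso ⟨q.1.out⁻¹ * q.2.2 * q.2.1.out, h⟩ : G) else 0
  obtain ⟨K, hK⟩ := (Set.finite_range F).bddAbove
  have step : ∀ (g s : G), s ∈ S →
      wordDist S (φ.toMap g) (φ.toMap (g * s)) ≤ K := by
    intro g s hs
    rw [wordDist]
    set q : G ⧸ φ.dom := QuotientGroup.mk g⁻¹ with hq
    set r : G ⧸ φ.dom := QuotientGroup.mk (g * s)⁻¹ with hr
    have e : ((proj φ.dom g)⁻¹ * proj φ.dom (g * s) : φ.dom) = q.out⁻¹ * s * r.out := by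
      simp only [proj, Subgroup.coe_mul, Subgroup.coe_inv]
      rw [← hq, ← hr]
      group
    have h : q.out⁻¹ * s * r.out ∈ φ.dom := by
      rw [← e]
      exact SetLike.coe_mem _
    have : (φ.toMap g)⁻¹ * φ.toMap (g * s) = φ.iso ⟨q.out⁻¹ * s * r.out, h⟩ := by
      rw [← (Subtype.ext e : (proj φ.dom g)⁻¹ * proj φ.dom (g * s) = ⟨_, h⟩), map_mul, map_inv]
      rfl
    rw [this]
    have := hK ⟨(q, r, ⟨s, hs⟩), rfl⟩
    simp only [F, dif_pos h] at this
    exact_mod_cast this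
  have main : ∀ (l : List G), (∀ x ∈ l, x ∈ S ∨ x⁻¹ ∈ S) → ∀ g : G,
      wordDist S (φ.toMap g) (φ.toMap (g * l.prod)) ≤ K * l.length := by
    intro l
    induction l with
    | nil => intro _ g; simp [wordDist_self]
    | cons x l ih =>
      intro hl g
      have h1 : wordDist S (φ.toMap g) (φ.toMap (g * x)) ≤ K := by
        rcases hl x (by simp) with hx | hx
        · exact step g x hx
        · have := step (g * x) x⁻¹ hx
          rw [mul_inv_cancel_right, wordDist_comm hS] at this
          exact this
      have h2 := ih (fun y hy => hl y (List.mem_cons_of_mem _ hy)) (g * x)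
      rw [List.prod_cons, ← mul_assoc, List.length_cons]
      have h3 := wordDist_triangle hS (φ.toMap g) (φ.toMap (g * x))
        (φ.toMap (g * x * l.prod))
      push_cast
      linarith
  refine ⟨K, Nat.cast_nonneg K, fun g h => ?_⟩
  obtain ⟨l, hl, hp, hn⟩ := exists_word hS (g⁻¹ * h)
  have := main l hl g
  rw [hp, mul_inv_cancel_left, hn] at this
  exact this

/-- Lipschitz maps at bounded distance on a finite index subgroup are at bounded distance. -/
theorem boundedDistance_of_finiteIndex (hS : Subgroup.closure S = ⊤)
    {f f' : G → G} {K K' C : ℝ} (hK : 0 ≤ K) (hK' : 0 ≤ K')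
    (hf : ∀ g h : G, wordDist S (f g) (f h) ≤
      K * wordDist S g h)
    (hf' : ∀ g h : G, wordDist S (f' g) (f' h) ≤
      K' * wordDist S g h)
    (A : Subgroup G) [A.FiniteIndex]
    (h : ∀ a ∈ A, wordDist S (f a) (f' a) ≤ C) :
    BoundedDistance (Y := WordMetricSpace S hS) f f' := by
  obtain ⟨D, hD⟩ := exists_dist_proj_le S A
  refine ⟨K * D + C + K' * D, fun g => ?_⟩
  have h1 := wordDist_triangle4 hS (f g) (f (proj A g)) (f' (proj A g)) (f' g)
  have h2 := (hf g (proj A g)).trans (mul_le_mul_of_nonneg_left (hD g) hK)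
  have h3 := hf' g (proj A g)
  rw [wordDist_comm hS] at h3
  have h4 := h3.trans (mul_le_mul_of_nonneg_left (hD g) hK')
  have h5 := h _ (proj A g).2
  show wordDist S (f g) (f' g) ≤ _
  linarith

theorem toMap_congr (hS : Subgroup.closure S = ⊤) (hfin : S.Finite)
    {φ ψ : Commensuration G} (h : φ.Equivalent ψ) :
    BoundedDistance (Y := WordMetricSpace S hS) φ.toMap ψ.toMap := by
  obtain ⟨A, hA, h₁, h₂, h⟩ := h
  obtain ⟨K, hK, hφ⟩ := φ.exists_lipschitz_toMap hS hfin
  obtain ⟨K', hK', hψ⟩ := ψ.exists_lipschitz_toMap hS hfin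
  obtain ⟨C, hC⟩ := φ.exists_dist_toMap_le hS
  obtain ⟨D, hD⟩ := ψ.exists_dist_toMap_le hS
  refine boundedDistance_of_finiteIndex hS (C := C + D) hK hK' hφ hψ A fun a ha => ?_
  have h1 := hC ⟨a, h₁ ha⟩
  have h2 := hD ⟨a, h₂ ha⟩
  rw [← h a ha, wordDist_comm hS] at h2
  exact (wordDist_triangle hS _ _ _).trans (add_le_add h1 h2)

theorem toMap_id (hS : Subgroup.closure S = ⊤) (hfin : S.Finite) :
    BoundedDistance (Y := WordMetricSpace S hS) (Commensuration.id G).toMap (fun g => g) := by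
  obtain ⟨K, hK, h⟩ := (Commensuration.id G).exists_lipschitz_toMap hS hfin
  obtain ⟨C, hC⟩ := (Commensuration.id G).exists_dist_toMap_le hS
  exact boundedDistance_of_finiteIndex hS (K' := 1) hK zero_le_one h
    (fun g h => by rw [one_mul]) (⊤ : Subgroup G) fun a ha => hC ⟨a, ha⟩

theorem toMap_comp (hS : Subgroup.closure S = ⊤) (hfin : S.Finite) (ψ φ : Commensuration G) :
    BoundedDistance (Y := WordMetricSpace S hS) (ψ.comp φ).toMap
      (fun g => ψ.toMap (φ.toMap g)) := by
  obtain ⟨K, hK, hφ⟩ := φ.exists_lipschitz_toMap hS hfin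
  obtain ⟨L, hL, hψ⟩ := ψ.exists_lipschitz_toMap hS hfin
  obtain ⟨M, hM, hc⟩ := (ψ.comp φ).exists_lipschitz_toMap hS hfin
  obtain ⟨C, hC⟩ := φ.exists_dist_toMap_le hS
  obtain ⟨D, hD⟩ := ψ.exists_dist_toMap_le hS
  obtain ⟨E, hE⟩ := (ψ.comp φ).exists_dist_toMap_le hS
  have := (ψ.comp φ).finite_dom
  refine boundedDistance_of_finiteIndex hS (C := E + (D + L * C)) (K' := L * K) hM
    (mul_nonneg hL hK) hc (fun g h => ?_) (ψ.comp φ).dom fun a ha => ?_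
  · rw [mul_assoc]
    exact (hψ _ _).trans (mul_le_mul_of_nonneg_left (hφ g h) hL)
  · obtain ⟨h1, h2⟩ := mem_preimage.1 ha
    have e1 := hE ⟨a, ha⟩
    have e2 := hD ⟨_, h2⟩
    have e3 := (hψ (φ.toMap a) (φ.iso ⟨a, h1⟩)).trans
      (mul_le_mul_of_nonneg_left (hC ⟨a, h1⟩) hL)
    rw [wordDist_comm hS] at e2 e3
    exact (wordDist_triangle4 hS ((ψ.comp φ).toMap a)
      ((ψ.comp φ).iso ⟨a, ha⟩ : G) (ψ.toMap (φ.iso ⟨a, h1⟩)) (ψ.toMap (φ.toMap a))).trans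
      (by
        have e2' : wordDist S ((ψ.comp φ).iso ⟨a, ha⟩ : G)
          (ψ.toMap (φ.iso ⟨a, h1⟩)) ≤ D := e2
        linarith)

theorem isQuasiIsometry_toMap (hS : Subgroup.closure S = ⊤) (hfin : S.Finite)
    (φ : Commensuration G) :
    IsQuasiIsometry (X := WordMetricSpace S hS) (Y := WordMetricSpace S hS) φ.toMap := by
  have key : ∀ φ : Commensuration G, BoundedDistance (Y := WordMetricSpace S hS)
      (fun g => φ.symm.toMap (φ.toMap g)) (fun g => g) := fun φ =>
    ((toMap_comp hS hfin φ.symm φ).symm.trans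
      (toMap_congr hS hfin (Quotient.exact (inv_mul_cancel (Com.mk φ))))).trans
        (toMap_id hS hfin)
  obtain ⟨K, hK, hf⟩ := φ.exists_lipschitz_toMap hS hfin
  obtain ⟨L, hL, hg⟩ := φ.symm.exists_lipschitz_toMap hS hfin
  obtain ⟨D, hD⟩ := key φ
  obtain ⟨E, hE⟩ := key φ.symm
  exact IsQuasiIsometry.of_coarseInverse (X := WordMetricSpace S hS) (Y := WordMetricSpace S hS)
    (g := φ.symm.toMap) (C := 0) (D := max D E)
    (fun x y => by rw [add_zero]; exact hf x y) (fun x y => by rw [add_zero]; exact hg x y)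
    (fun x => (hD x).trans (le_max_left _ _)) (fun x => (hE x).trans (le_max_right _ _))

end Commensuration

/-- The natural homomorphism `Com(G) → QI(G)` of a group `G` with finite generating set `S`: the
class of `φ : A ≃* B` goes to the class of the quasi-isometry `φ.toMap`. -/
noncomputable def comToQI {G : Type*} [Group G] (S : Set G) (hfin : S.Finite)
    (hS : Subgroup.closure S = ⊤) : Com G →* QI (WordMetricSpace S hS) where
  toFun := Quotient.lift (fun φ => QI.mk φ.toMap (φ.isQuasiIsometry_toMap hS hfin))
    fun _ _ h => QI.mk_eq_mk.2 (Commensuration.toMap_congr hS hfin h)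
  map_one' := QI.mk_eq_mk.2 (Commensuration.toMap_id hS hfin)
  map_mul' := by
    rintro ⟨ψ⟩ ⟨φ⟩
    exact QI.mk_eq_mk.2 (Commensuration.toMap_comp hS hfin ψ φ)

/-- The image of the class of `φ` under the natural homomorphism is the class of any
quasi-isometry that is at bounded distance from `φ` on the domain of `φ`. -/
theorem comToQI_mk_eq_iff {G : Type*} [Group G] (S : Set G) (hfin : S.Finite)
    (hS : Subgroup.closure S = ⊤) (φ : Commensuration G)
    (f : G → G)
    (hf : IsQuasiIsometry (X := WordMetricSpace S hS) (Y := WordMetricSpace S hS) f) :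
    comToQI S hfin hS (Com.mk φ) = QI.mk (X := WordMetricSpace S hS) f hf ↔
      BoundedDistance (Y := WordMetricSpace S hS)
        (fun a : φ.dom => f (a : G)) (fun a : φ.dom => (φ.iso a : G)) := by
  have := φ.finite_dom
  obtain ⟨C, hC⟩ := φ.exists_dist_toMap_le hS
  refine (QI.mk_eq_mk (hf := φ.isQuasiIsometry_toMap hS hfin)).trans ⟨?_, ?_⟩
  · rintro ⟨D, hD⟩
    refine ⟨D + C, fun a => ?_⟩
    have h1 : wordDist S (φ.toMap a) (f (a : G)) ≤ D := hD (a : G)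
    rw [wordDist_comm hS] at h1
    exact (wordDist_triangle hS _ _ _).trans (add_le_add h1 (hC a))
  · rintro ⟨D, hD⟩
    obtain ⟨K, hK, hφ⟩ := φ.exists_lipschitz_toMap hS hfin
    obtain ⟨L, B, hL, -, hf', -⟩ := hf
    obtain ⟨E, hE⟩ := Commensuration.exists_dist_proj_le S φ.dom
    refine ⟨K * E + C + D + (L * E + B), fun g => ?_⟩
    set p := Commensuration.proj φ.dom g
    have h1 := (hφ g p).trans (mul_le_mul_of_nonneg_left (hE g) hK)
    have h2 := hC p
    have h3 : wordDist S (f (p : G)) (φ.iso p : G) ≤ D := hD p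
    have h4 : wordDist S (f g) (f (p : G)) ≤ L * E + B := ((hf' g (p : G)).2).trans
      (add_le_add_left (mul_le_mul_of_nonneg_left (hE g) (by linarith : 0 ≤ L)) B)
    rw [wordDist_comm hS] at h3 h4
    have h5 := wordDist_triangle4 hS (φ.toMap g) (φ.toMap p)
      (φ.iso p : G) (f (p : G))
    have h6 := wordDist_triangle hS (φ.toMap g) (f (p : G)) (f g)
    show wordDist S (φ.toMap g) (f g) ≤ _
    linarith

/-! ### Commensurations at bounded distance from the identity -/

/-! Suppose `φ : A → B` stays at distance at most `N` from the identity and put `c(a) = a⁻¹ φ(a)`.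
Multiplicativity of `φ` gives `b⁻¹ c(a) b = c(ab) c(b)⁻¹` for `a, b ∈ A`, an element of length at
most `2N`. Balls in the word metric are finite, so `c(a)` has finitely many conjugates under `A`,
and hence under the whole group because `A` has finite index. If only the identity has a finite
conjugacy class, then `c(a) = 1` and `φ` is the identity on `A`. This is
`Commensuration.equivalent_id_of_wordLength_le`; since a class in the kernel of `comToQI` is
represented by such a `φ`, injectivity follows.

Two facts about `H_n` remain. `HoughtonGroup.eq_one_of_finite_range_conj`: conjugating a nontrivial
element by transpositions already gives infinitely many elements. `HoughtonGroup.group_fg`: sending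
an element to its translation lengths is a homomorphism into the vectors of sum zero, and its kernel
consists of the finitely supported permutations. The shifts from one ray `o` to the other rays
realise generators `e_i - e_o` of that lattice. When there is a second ray, conjugating a single
transposition by the shifts yields all transpositions, hence the kernel. -/

theorem finite_setOf_wordLength_le {G : Type*} [Group G] {S : Set G} (hfin : S.Finite)
    (hS : Subgroup.closure S = ⊤) (N : ℕ) : {g : G | wordLength S g ≤ N}.Finite := by
  have : Finite ↥(S ∪ S⁻¹) := (hfin.union hfin.inv).to_subtype
  refine ((List.finite_length_le ↥(S ∪ S⁻¹) N).image
    fun l => (l.map Subtype.val).prod).subset fun g hg => ?_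
  obtain ⟨l, hl, hp, hn⟩ := exists_word hS g
  lift l to List ↥(S ∪ S⁻¹) using fun x hx => by simpa using hl x hx
  exact ⟨l, by simpa using hn.trans_le hg, hp⟩

/-- If finitely many conjugates of `g` by elements of a finite index subgroup exist, then `g` has
a finite conjugacy class. -/
theorem Subgroup.finite_range_conj_of_finiteIndex {G : Type*} [Group G] (A : Subgroup G)
    [A.FiniteIndex] {g : G} (h : (Set.range fun a : A => (a : G)⁻¹ * g * a).Finite) :
    (Set.range fun x : G => x⁻¹ * g * x).Finite := by
  -- `proj A x = x * q.out` with `q` the coset of `x⁻¹`. So `x = a * q.out⁻¹` with `a ∈ A`, and `x⁻¹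
  -- g x` is the conjugate of `a⁻¹ g a` by one of finitely many representatives.
  refine (Set.Finite.image2 (fun (y : G) (q : G ⧸ A) => q.out * y * q.out⁻¹) h
    Set.finite_univ).subset ?_
  rintro _ ⟨x, rfl⟩
  refine ⟨_, ⟨Commensuration.proj A x, rfl⟩, QuotientGroup.mk x⁻¹, Set.mem_univ _, ?_⟩
  simp only [Commensuration.proj]
  group

/-- In a finitely generated group without nontrivial finite conjugacy classes, a commensuration at
bounded distance from the identity restricts to the identity. -/
theorem Commensuration.equivalent_id_of_wordLength_le {G : Type*} [Group G] {S : Set G}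
    (hfin : S.Finite) (hS : Subgroup.closure S = ⊤)
    (hG : ∀ g : G, (Set.range fun x : G => x⁻¹ * g * x).Finite → g = 1)
    (φ : Commensuration G) {N : ℕ}
    (hN : ∀ a : φ.dom, wordLength S ((a : G)⁻¹ * (φ.iso a : G)) ≤ N) :
    φ.Equivalent (Commensuration.id G) := by
  have := φ.finite_dom
  refine ⟨φ.dom, φ.finite_dom, le_rfl, le_top, fun a ha => ?_⟩
  suffices h : a⁻¹ * (φ.iso ⟨a, ha⟩ : G) = 1 from (inv_mul_eq_one.1 h).symm
  refine hG _ (φ.dom.finite_range_conj_of_finiteIndex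
    ((finite_setOf_wordLength_le hfin hS (N + N)).subset ?_))
  rintro _ ⟨b, rfl⟩
  -- The cocycle identity `b⁻¹ c(a) b = c(ab) c(b)⁻¹` for `c(a) = a⁻¹ φ(a)`.
  have e : (b : G)⁻¹ * (a⁻¹ * (φ.iso ⟨a, ha⟩ : G)) * b =
      ((⟨a, ha⟩ * b : φ.dom) : G)⁻¹ * (φ.iso (⟨a, ha⟩ * b) : G) *
        ((b : G)⁻¹ * (φ.iso b : G))⁻¹ := by
    rw [map_mul]
    push_cast
    group
  show wordLength S ((b : G)⁻¹ * (a⁻¹ * (φ.iso ⟨a, ha⟩ : G)) * b) ≤ N + N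
  rw [e]
  refine (wordLength_mul_le hS _ _).trans (add_le_add (hN _) ?_)
  rw [wordLength_inv hS]
  exact hN b

/-- In a finitely generated group without nontrivial finite conjugacy classes, the natural
homomorphism from the commensurator to the quasi-isometry group is injective. -/
theorem comToQI_injective {G : Type*} [Group G] {S : Set G}
    (hfin : S.Finite) (hS : Subgroup.closure S = ⊤)
    (hG : ∀ g : G, (Set.range fun x : G => x⁻¹ * g * x).Finite → g = 1) :
    Function.Injective (comToQI S hfin hS) := by
  rw [injective_iff_map_eq_one]
  rintro ⟨φ⟩ h
  -- The unit of `QI` is by definition the class of the identity map, so `h` has the form required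
  -- by the criterion with `f` the identity.
  obtain ⟨C, hC⟩ := (comToQI_mk_eq_iff S hfin hS φ (fun g => g) (IsQuasiIsometry.id _)).1 h
  refine Quotient.sound (φ.equivalent_id_of_wordLength_le hfin hS hG (N := ⌈C⌉₊) fun a => ?_)
  have h1 : (wordLength S ((a : G)⁻¹ * (φ.iso a : G)) : ℝ) ≤ C := hC a
  exact_mod_cast h1.trans (Nat.le_ceil C)

/-! ### Translation vectors -/

/-- `σ` is eventually the translation by `t i` on the ray `i`. -/
def HasTranslationVector {n : ℕ} (σ : Equiv.Perm (Rays n)) (t : Fin n → ℤ) : Prop :=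
  ∃ N : ℕ, ∀ (i : Fin n) (k : ℕ+), N ≤ (k : ℕ) →
    (σ (i, k)).1 = i ∧ (((σ (i, k)).2 : ℕ) : ℤ) = ((k : ℕ) : ℤ) + t i

namespace HasTranslationVector

variable {n : ℕ} {σ τ : Equiv.Perm (Rays n)} {t u : Fin n → ℤ}

theorem mem_houghtonGroup (h : HasTranslationVector σ t) : σ ∈ HoughtonGroup n :=
  let ⟨N, h⟩ := h
  ⟨N, t, h⟩

theorem mul (hσ : HasTranslationVector σ t) (hτ : HasTranslationVector τ u) :
    HasTranslationVector (σ * τ) (t + u) := by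
  obtain ⟨N, h⟩ := hσ
  obtain ⟨M, h'⟩ := hτ
  -- Beyond this threshold `τ` translates, and its image is still at height at least `N`, where `σ`
  -- translates.
  refine ⟨M + (N + ∑ i, (u i).natAbs), fun i k hk => ?_⟩
  obtain ⟨h1, h2⟩ := h' i k (by omega)
  have hi : (u i).natAbs ≤ ∑ i, (u i).natAbs :=
    Finset.single_le_sum (f := fun i => (u i).natAbs) (fun _ _ => Nat.zero_le _)
      (Finset.mem_univ i)
  obtain ⟨h3, h4⟩ := h i (τ (i, k)).2 (by omega)
  rw [Equiv.Perm.mul_apply, ← Prod.mk.eta (p := τ (i, k)), h1]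
  exact ⟨h3, by rw [h4, h2, Pi.add_apply]; ring⟩

theorem unique (ht : HasTranslationVector σ t) (hu : HasTranslationVector σ u) : t = u := by
  obtain ⟨N, h⟩ := ht
  obtain ⟨M, h'⟩ := hu
  funext i
  have h1 := (h i (N + M).succPNat (by simp; omega)).2
  have h2 := (h' i (N + M).succPNat (by simp; omega)).2
  omega

theorem one : HasTranslationVector (1 : Equiv.Perm (Rays n)) 0 :=
  ⟨0, fun i k _ => by simp⟩

/-- The inverse has some translation vector because `H_n` is a subgroup; additivity and uniqueness
force it to be `-t`. -/
theorem inv (h : HasTranslationVector σ t) : HasTranslationVector σ⁻¹ (-t) := by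
  obtain ⟨N, u, hu⟩ := inv_mem h.mem_houghtonGroup
  have hu : HasTranslationVector σ⁻¹ u := ⟨N, hu⟩
  have h1 := h.mul hu
  rw [mul_inv_cancel] at h1
  rwa [neg_eq_of_add_eq_zero_right (h1.unique one)]

theorem of_finite (h : {x | σ x ≠ x}.Finite) : HasTranslationVector σ 0 := by
  obtain ⟨N, hN⟩ := (h.image fun x => (x.2 : ℕ)).bddAbove
  refine ⟨N + 1, fun i k hk => ?_⟩
  have : σ (i, k) = (i, k) := by
    by_contra hne
    have : (k : ℕ) ≤ N := hN ⟨(i, k), hne, rfl⟩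
    omega
  simp [this]

/-- Converse of `of_finite`: the kernel of the translation homomorphism is the group of finitely
supported permutations. -/
theorem finite_of_zero (h : HasTranslationVector σ 0) : {x | σ x ≠ x}.Finite := by
  obtain ⟨N, hN⟩ := h
  refine (Set.finite_univ.prod (Set.finite_Iio N.succPNat)).subset ?_
  rintro ⟨i, k⟩ hx
  refine ⟨Set.mem_univ _, ?_⟩
  by_contra hk
  have hk' : N ≤ (k : ℕ) := by
    have : N.succPNat ≤ k := not_lt.1 hk
    have : (N.succPNat : ℕ) ≤ k := this
    rw [Nat.succPNat_coe] at this
    omega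
  obtain ⟨h1, h2⟩ := hN i k hk'
  exact hx (Prod.ext h1 (PNat.eq (by simpa using h2)))

/-- The translation lengths of an element of the Houghton group sum up to zero: compare the sizes
of the complements of a neighbourhood of infinity and of its image. -/
theorem sum_eq_zero (h : HasTranslationVector σ t) : ∑ i, t i = 0 := by
  obtain ⟨N, hN⟩ := h
  -- `M` exceeds `N`, so `σ` translates above height `M`. Moreover `M + t i ≥ N + 1`, so the shifted
  -- heights are positive.
  set M : ℕ := N + 1 + ∑ i, (t i).natAbs with hM
  have hi : ∀ i, (t i).natAbs ≤ ∑ i, (t i).natAbs := fun i =>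
    Finset.single_le_sum (f := fun i => (t i).natAbs) (fun _ _ => Nat.zero_le _)
      (Finset.mem_univ i)
  have hpos : ∀ i, 0 < ((M : ℤ) + t i).toNat := fun i => by have := hi i; omega
  let f : Fin n → ℕ+ := fun i => ⟨((M : ℤ) + t i).toNat, hpos i⟩
  have hf : ∀ i, ((f i : ℕ) : ℤ) = M + t i := fun i => by
    have := hi i
    show ((((M : ℤ) + t i).toNat : ℕ) : ℤ) = _
    omega
  let m : ℕ+ := ⟨M, by omega⟩
  -- The part of each ray `i` up to height `g i`, as a sigma type because the height depends on the
  -- ray.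
  let box : (Fin n → ℕ+) → Finset (Σ _ : Fin n, ℕ+) := fun g =>
    Finset.univ.sigma fun i => Finset.Icc 1 (g i)
  have hbox : ∀ (g : Fin n → ℕ+) (x : Rays n),
      (⟨x.1, x.2⟩ : Σ _ : Fin n, ℕ+) ∈ box g ↔ (x.2 : ℕ) ≤ g x.1 := fun g x => by
    simp [box]
  have hcard : ∀ g, (box g).card = ∑ i, (g i : ℕ) := fun g => by
    simp [box, Finset.card_sigma, PNat.card_Icc]
  -- `σ` carries the box of constant height `M` exactly onto the box of heights `M + t i`. This is
  -- checked on the complements, where `σ` is a translation.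
  have hσ : ∀ x : Rays n, (x.2 : ℕ) ≤ m ↔ ((σ x).2 : ℕ) ≤ f (σ x).1 := by
    have hmM : (m : ℕ) = M := rfl
    intro x
    rw [← not_iff_not, not_le, not_le]
    constructor
    · intro hx
      obtain ⟨h1, h2⟩ := hN x.1 x.2 (by omega)
      have := hf x.1
      rw [Prod.mk.eta] at h1 h2
      rw [h1]
      omega
    · intro hx
      set y := σ x with hy
      have h1 := hf y.1
      have h2 := hi y.1
      -- The point of ray `y.1` that the translation sends to `y`; injectivity of `σ` identifies it
      -- with `x`.
      let k : ℕ+ := ⟨(((y.2 : ℕ) : ℤ) - t y.1).toNat, by omega⟩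
      have hk : ((k : ℕ) : ℤ) = ((y.2 : ℕ) : ℤ) - t y.1 := by
        show ((Int.toNat _ : ℕ) : ℤ) = _
        omega
      obtain ⟨h3, h4⟩ := hN y.1 k (by omega)
      have h5 : σ (y.1, k) = σ x :=
        Prod.ext h3 (PNat.eq (by rw [← hy]; omega))
      rw [← σ.injective h5]
      show (m : ℕ) < (k : ℕ)
      omega
  have key : (box fun _ => m).card = (box f).card := by
    refine Finset.card_bij' (fun x _ => ⟨(σ (x.1, x.2)).1, (σ (x.1, x.2)).2⟩)
      (fun x _ => ⟨(σ.symm (x.1, x.2)).1, (σ.symm (x.1, x.2)).2⟩) ?_ ?_ ?_ ?_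
    · intro x hx
      exact (hbox _ _).2 ((hσ _).1 ((hbox _ (x.1, x.2)).1 hx))
    · intro x hx
      refine (hbox _ _).2 ((hσ _).2 ?_)
      rw [σ.apply_symm_apply]
      exact (hbox _ (x.1, x.2)).1 hx
    · intro x _
      simp
    · intro x _
      simp
  rw [hcard, hcard] at key
  have key' : ∑ _i : Fin n, (M : ℤ) = ∑ i, (M + t i) := by
    rw [← Finset.sum_congr rfl fun i _ => hf i]
    exact_mod_cast key
  rw [Finset.sum_add_distrib] at key'
  omega

end HasTranslationVector

/-! ### Conjugacy classes in Houghton's groups -/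

theorem swap_mem_houghtonGroup {n : ℕ} (x y : Rays n) : Equiv.swap x y ∈ HoughtonGroup n :=
  (HasTranslationVector.of_finite ((Set.toFinite {x, y}).subset fun z hz => by
    by_contra h
    simp only [Set.mem_insert_iff, Set.mem_singleton_iff, not_or] at h
    exact hz (Equiv.swap_apply_of_ne_of_ne h.1 h.2))).mem_houghtonGroup

/-- If `σ x ≠ x`, then for every `z` other than `x` and `σ x` the transposition of `σ x` and `z`
fixes `x`, so conjugating `σ` by it gives an element sending `x` to `z`. The infinitely many choices
of `z` give distinct conjugates. -/
theorem HoughtonGroup.eq_one_of_finite_range_conj {n : ℕ} (σ : HoughtonGroup n)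
    (h : (Set.range fun x : HoughtonGroup n => x⁻¹ * σ * x).Finite) : σ = 1 := by
  by_contra hne
  obtain ⟨x, hx⟩ : ∃ x, σ.1 x ≠ x := by
    by_contra! hx
    exact hne (Subtype.ext (Equiv.ext hx))
  -- Needed for `Rays n` to be infinite.
  have : Nonempty (Fin n) := ⟨x.1⟩
  refine (Set.toFinite {x, σ.1 x}).infinite_compl
    ((h.image fun τ : HoughtonGroup n => τ.1 x).subset fun z hz => ?_)
  simp only [Set.mem_compl_iff, Set.mem_insert_iff, Set.mem_singleton_iff, not_or] at hz
  refine ⟨_, ⟨⟨_, swap_mem_houghtonGroup (σ.1 x) z⟩, rfl⟩, ?_⟩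
  show (Equiv.swap (σ.1 x) z)⁻¹ (σ.1 (Equiv.swap (σ.1 x) z x)) = z
  rw [Equiv.swap_apply_of_ne_of_ne hx.symm (Ne.symm hz.1), Equiv.swap_inv,
    Equiv.swap_apply_left]

/-! ### Finite generation of Houghton's groups -/

/-- Translation by one along the line formed by the rays `a` and `b`, from `a` to `b`. -/
def rayShiftFun {n : ℕ} (a b : Fin n) (x : Rays n) : Rays n :=
  if x.1 = b then (b, x.2 + 1) else if x.1 = a then if x.2 = 1 then (b, 1) else (a, x.2 - 1)
    else x

theorem rayShiftFun_rayShiftFun {n : ℕ} {a b : Fin n} (h : a ≠ b) (x : Rays n) :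
    rayShiftFun b a (rayShiftFun a b x) = x := by
  obtain ⟨i, k⟩ := x
  by_cases hb : i = b
  · subst hb
    have : k + 1 ≠ 1 := (PNat.lt_add_left 1 k).ne'
    simp [rayShiftFun, h.symm, this, PNat.add_sub]
  · by_cases ha : i = a
    · subst ha
      by_cases hk : k = 1
      · simp [rayShiftFun, h, h.symm, hk]
      · have : k - 1 + 1 = k := PNat.sub_add_of_lt (one_le.lt_of_ne (Ne.symm hk))
        simp [rayShiftFun, h, hk, this]
    · simp [rayShiftFun, ha, hb]

/-- The permutation `rayShiftFun a b`. -/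
def rayShift {n : ℕ} {a b : Fin n} (h : a ≠ b) : Equiv.Perm (Rays n) where
  toFun := rayShiftFun a b
  invFun := rayShiftFun b a
  left_inv := rayShiftFun_rayShiftFun h
  right_inv := rayShiftFun_rayShiftFun h.symm

section rayShift

variable {n : ℕ} {a b : Fin n} (h : a ≠ b)

theorem rayShift_apply_right (k : ℕ+) : rayShift h (b, k) = (b, k + 1) := by
  simp [rayShift, rayShiftFun]

theorem rayShift_apply_left_one : rayShift h (a, 1) = (b, 1) := by
  simp [rayShift, rayShiftFun, h]

theorem rayShift_apply_left_add_one (k : ℕ+) : rayShift h (a, k + 1) = (a, k) := by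
  have : k + 1 ≠ 1 := (PNat.lt_add_left 1 k).ne'
  simp [rayShift, rayShiftFun, h, this, PNat.add_sub]

theorem rayShift_apply_of_ne {i : Fin n} (hia : i ≠ a) (hib : i ≠ b) (k : ℕ+) :
    rayShift h (i, k) = (i, k) := by
  simp [rayShift, rayShiftFun, hia, hib]

theorem hasTranslationVector_rayShift :
    HasTranslationVector (rayShift h) (Pi.single b 1 - Pi.single a 1) := by
  -- The only exception to the translation rule is `(a, 1)`, which jumps to ray `b`.
  refine ⟨2, fun i k hk => ?_⟩
  by_cases hb : i = b
  · subst hb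
    simp [rayShift_apply_right, h.symm]
  · by_cases ha : i = a
    · subst ha
      obtain ⟨k, rfl⟩ : ∃ l : ℕ+, k = l + 1 :=
        ⟨k - 1, (PNat.sub_add_of_lt (show (1 : ℕ) < k by omega)).symm⟩
      simp [rayShift_apply_left_add_one, hb]
    · simp [rayShift_apply_of_ne h ha hb, ha, hb]

end rayShift

/-- Outside the degenerate cases, `(x z)` is the conjugate of `(x y)` by `(y z)`. Thus a chain of
transpositions in `K` linking two points puts their own transposition in `K`. -/
theorem Subgroup.swap_mem_trans {α : Type*} [DecidableEq α] {K : Subgroup (Equiv.Perm α)}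
    {x y z : α} (hxy : Equiv.swap x y ∈ K) (hyz : Equiv.swap y z ∈ K) :
    Equiv.swap x z ∈ K := by
  by_cases h1 : x = y
  · rwa [h1]
  by_cases h2 : x = z
  · rw [h2, Equiv.swap_self]
    exact K.one_mem
  rw [Equiv.swap_comm, ← Equiv.swap_mul_swap_mul_swap h1 h2]
  exact K.mul_mem (K.mul_mem hyz hxy) hyz

/-- The shifts from a fixed ray `o` to the other rays and one transposition of adjacent points
on `o` generate all transpositions. -/
theorem swap_mem_of_rayShift_mem {n : ℕ} {K : Subgroup (Equiv.Perm (Rays n))} {o j : Fin n}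
    (hj : o ≠ j) (hK : ∀ (i : Fin n) (h : o ≠ i), rayShift h ∈ K)
    (hs : Equiv.swap ((o, 1) : Rays n) (o, 2) ∈ K) (x y : Rays n) : Equiv.swap x y ∈ K := by
  have conj : ∀ {g : Equiv.Perm (Rays n)}, g ∈ K → ∀ {x y}, Equiv.swap x y ∈ K →
      Equiv.swap (g x) (g y) ∈ K := fun hg x y h => by
    rw [Equiv.swap_apply_apply]
    exact K.mul_mem (K.mul_mem hg h) (K.inv_mem hg)
  -- The inverse of a shift out of `o` pushes adjacent pairs outward along `o`; the second ray `j`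
  -- supplies this shift.
  have ho : ∀ k : ℕ+, Equiv.swap ((o, k) : Rays n) (o, k + 1) ∈ K := fun k => by
    induction k with
    | one => exact hs
    | succ k ih =>
      have e : ∀ k : ℕ+, (rayShift hj)⁻¹ (o, k) = (o, k + 1) := fun k => by
        rw [Equiv.Perm.inv_eq_iff_eq, rayShift_apply_left_add_one]
      have := conj (K.inv_mem (hK j hj)) ih
      rwa [e, e] at this
  have hi : ∀ (i : Fin n), o ≠ i → ∀ k : ℕ+,
      Equiv.swap ((i, k) : Rays n) (i, k + 1) ∈ K := fun i h k => by
    induction k with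
    | one =>
      -- Two applications of the shift take `(o, 1), (o, 2)` to `(i, 2), (i, 1)`.
      have h1 := conj (hK i h) (conj (hK i h) hs)
      rw [rayShift_apply_left_one, show (2 : ℕ+) = 1 + 1 from rfl,
        rayShift_apply_left_add_one, rayShift_apply_left_one, rayShift_apply_right,
        Equiv.swap_comm] at h1
      exact h1
    | succ k ih =>
      have := conj (hK i h) ih
      rwa [rayShift_apply_right, rayShift_apply_right] at this
  have h0 : ∀ x : Rays n, Equiv.swap ((o, 1) : Rays n) x ∈ K := by
    rintro ⟨i, k⟩
    induction k with
    | one =>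
      by_cases h : o = i
      · rw [h, Equiv.swap_self]
        exact K.one_mem
      -- One application of the shift takes `(o, 1), (o, 2)` to `(i, 1), (o, 1)`, which links the
      -- two rays.
      · have := conj (hK i h) hs
        rwa [rayShift_apply_left_one, show (2 : ℕ+) = 1 + 1 from rfl,
          rayShift_apply_left_add_one, Equiv.swap_comm] at this
    | succ k ih =>
      refine Subgroup.swap_mem_trans ih ?_
      by_cases h : o = i
      · exact h ▸ ho k
      · exact hi i h k
  refine Subgroup.swap_mem_trans (y := (o, 1)) ?_ (h0 y)
  rw [Equiv.swap_comm]
  exact h0 x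

/-- The translation vectors of the elements of a subgroup of the symmetric group. -/
def translationVectors {n : ℕ} (K : Subgroup (Equiv.Perm (Rays n))) :
    AddSubgroup (Fin n → ℤ) where
  carrier := {t | ∃ σ ∈ K, HasTranslationVector σ t}
  zero_mem' := ⟨1, K.one_mem, .one⟩
  add_mem' := fun ⟨σ, hσ, h⟩ ⟨τ, hτ, h'⟩ => ⟨σ * τ, K.mul_mem hσ hτ, h.mul h'⟩
  neg_mem' := fun ⟨σ, hσ, h⟩ => ⟨σ⁻¹, K.inv_mem hσ, h.inv⟩

/-- Some `τ ∈ K` has the same translation vector as the given `σ`. Then `σ * τ⁻¹` has vector zero,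
hence finite support, and is a product of transpositions, all of which lie in `K`. -/
theorem houghtonGroup_le_of_rayShift_mem {n : ℕ} {K : Subgroup (Equiv.Perm (Rays n))}
    {o j : Fin n} (hj : o ≠ j) (hK : ∀ (i : Fin n) (h : o ≠ i), rayShift h ∈ K)
    (hs : Equiv.swap ((o, 1) : Rays n) (o, 2) ∈ K) : HoughtonGroup n ≤ K := by
  rintro σ ⟨N, t, hσ⟩
  have hσ : HasTranslationVector σ t := ⟨N, hσ⟩
  -- The terms at `o` add up to `(∑ i, t i) e_o`, which vanishes because the translation lengths sum
  -- to zero.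
  have ht : t = ∑ i, t i • (Pi.single i 1 - Pi.single o 1) := by
    simp_rw [smul_sub]
    rw [Finset.sum_sub_distrib, ← Finset.sum_smul, hσ.sum_eq_zero, zero_smul, sub_zero]
    exact pi_eq_sum_univ' t
  have hmem : t ∈ translationVectors K := by
    rw [ht]
    refine sum_mem fun i _ => AddSubgroup.zsmul_mem _ ?_ _
    by_cases h : o = i
    · rw [h, sub_self]
      exact AddSubgroup.zero_mem _
    · exact ⟨_, hK i h, hasTranslationVector_rayShift h⟩
  obtain ⟨τ, hτ, h⟩ := hmem
  have h0 := hσ.mul h.inv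
  rw [add_neg_cancel] at h0
  have hfin : σ * τ⁻¹ ∈ Subgroup.closure {σ : Equiv.Perm (Rays n) | σ.IsSwap} :=
    mem_closure_isSwap'.2 h0.finite_of_zero
  have hle : Subgroup.closure {σ : Equiv.Perm (Rays n) | σ.IsSwap} ≤ K := by
    rw [Subgroup.closure_le]
    rintro _ ⟨x, y, -, rfl⟩
    exact swap_mem_of_rayShift_mem hj hK hs x y
  exact (Subgroup.mul_mem_cancel_right K (K.inv_mem hτ)).1 (hle hfin)

theorem HoughtonGroup.group_fg {n : ℕ} (hn : 2 ≤ n) : Group.FG (HoughtonGroup n) := by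
  rw [Group.fg_iff_subgroup_fg, Subgroup.fg_iff]
  let o : Fin n := ⟨0, by omega⟩
  have hj : o ≠ ⟨1, by omega⟩ := by simp [o]
  refine ⟨insert (Equiv.swap ((o, 1) : Rays n) (o, 2))
    (Set.range fun i : {i : Fin n // o ≠ i} => rayShift i.2), le_antisymm ?_ ?_,
    (Set.finite_range _).insert _⟩
  · rw [Subgroup.closure_le]
    rintro _ (rfl | ⟨i, rfl⟩)
    · exact swap_mem_houghtonGroup _ _
    · exact (hasTranslationVector_rayShift i.2).mem_houghtonGroup
  · exact houghtonGroup_le_of_rayShift_mem hj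
      (fun i h => Subgroup.subset_closure (Or.inr ⟨⟨i, h⟩, rfl⟩))
      (Subgroup.subset_closure (Or.inl rfl))

theorem mainTheorem5 (n : ℕ) (hn : 2 ≤ n) :
    Group.FG (HoughtonGroup n) ∧
    ∀ (S : Set (HoughtonGroup n)) (hfin : S.Finite) (hS : Subgroup.closure S = ⊤),
      Function.Injective (comToQI S hfin hS) ∧
      ∀ φ : Commensuration (HoughtonGroup n),
        ¬ φ.Equivalent (Commensuration.id (HoughtonGroup n)) →
          ∀ N : ℕ, ∃ σ : φ.dom,
            N ≤ wordLength S ((σ : HoughtonGroup n)⁻¹ * (φ.iso σ : HoughtonGroup n)) := by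
  refine ⟨HoughtonGroup.group_fg hn, fun S hfin hS =>
    ⟨comToQI_injective hfin hS HoughtonGroup.eq_one_of_finite_range_conj, fun φ hφ N => ?_⟩⟩
  by_contra! h
  exact hφ (φ.equivalent_id_of_wordLength_le hfin hS
    HoughtonGroup.eq_one_of_finite_range_conj fun a => (h a).le)
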